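/- Let $(\Lambda,\mathcal A)$ be a measurable parameter space. For each $i\ge 1$ let $\mu_i$ be a $\sigma$-finite measure on a measurable space $\mathcal Y_i$, and for $\lambda\in\Lambda$ let $p_{\lambda,i}$ be a probability density with respect to $\mu_i$, such that $(\lambda,y)\mapsto p_{\lambda,i}(y)$ is jointly measurable for each $i$. Let $P_{\lambda,i}$ be the law with density $p_{\lambda,i}$ and let $P^{(n)}_\lambda=\bigotimes_{i=1}^n P_{\lambda,i}$ be the law of the independent, not necessarily identically distributed observations $Y^{(n)}=(Y_1,\dots,Y_n)$. Fix a true parameter $\lambda_0\in\Lambda$ and let $\Pi=\Pi_n$ be prior probability measures on $\Lambda$ (which may depend on $n$), with posterior $$\Pi(A\mid Y^{(n)})=\frac{\int_A\prod_{i=1}^n p_{\lambda,i}(Y_i)\,d\Pi(\lambda)}{\int_\Lambda\prod_{i=1}^n p_{\lambda,i}(Y_i)\,d\Pi(\lambda)}.$$ Define the semimetric $d_n\ge 0$ by $d_n^2(\lambda,\lambda')=\frac1n\sum_{i=1}^n\int(\sqrt{p_{\lambda,i}}-\sqrt{p_{\lambda',i}})^2\,d\mu_i$, and for probability measures $P,Q$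 put $K(P,Q)=\int\log(dP/dQ)\,dP$ (equal to $+\infty$ if $P\not\ll Q$ or the integral diverges) and $V_2(P,Q)=\int|\log(dP/dQ)-K(P,Q)|^2\,dP$ (equal to $+\infty$ if $K(P,Q)=+\infty$). For $\xi>0$ let $$B_n(\xi)=\bigl\{\lambda\in\Lambda:\ K(P^{(n)}_{\lambda_0},P^{(n)}_\lambda)\le n\xi^2,\ V_2(P^{(n)}_{\lambda_0},P^{(n)}_\lambda)\le n\xi^2\bigr\},$$ and let $N(\varepsilon,A,d)$ be the minimal number of $d$-balls $\{\lambda:d(\lambda,\lambda')\le\varepsilon\}$, $\lambda'\in\Lambda$, needed to cover $A\subset\Lambda$. Let $\xi_n>0$ satisfy $\xi_n\to0$ and $n\xi_n^2\to\infty$. Suppose there are a constant $C>0$ and an increasing sequence of measurable sieves $\mathcal F_n\subset\Lambda$ such that, for all sufficiently large $n$, (a) $\Pi(\Lambda\setminus\mathcal F_n)\le\exp(-n\xi_n^2(C+4))$; (b) $\log N(\xi_n,\mathcal F_n,d_n)\le n\xi_n^2$; (c) $\Pi(B_n(\xi_n))\ge\exp(-Cn\xi_n^2)$. Then there are constants $C_1>0$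 and $M_0>0$ such that for every $M\ge M_0$ $$\Pi\bigl(\lambda:\ d_n(\lambda,\lambda_0)\ge M\xi_n\bigm|Y^{(n)}\bigr)=O_{P^{(n)}_{\lambda_0}}\bigl(\exp(-C_1n\xi_n^2)\bigr),$$ that is, for every $\varepsilon>0$ there is $K>0$ such that for all sufficiently large $n$ the $P^{(n)}_{\lambda_0}$-probability that the left-hand side exceeds $K\exp(-C_1n\xi_n^2)$ is at most $\varepsilon$. -/

import Mathlib

open MeasureTheory Filter Topology
open scoped ENNReal NNReal

namespace PosteriorContraction

noncomputable section

universe u v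

/-- The marginal law `P_{l,i}` of the `i`-th observation: the measure with density `p i l` with
respect to the dominating measure `μ i`. -/
def marginalLaw {Λ : Type u} {Y : ℕ → Type v} [∀ i, MeasurableSpace (Y i)]
    (μ : ∀ i, Measure (Y i)) (p : ∀ i, Λ → Y i → ℝ≥0) (l : Λ) (i : ℕ) : Measure (Y i) :=
  (μ i).withDensity (fun y => (p i l y : ℝ≥0∞))

/-- The joint law `P_l^{(n)} = P_{l,0} ⊗ ⋯ ⊗ P_{l,n-1}` of the first `n` observations, which are
independent but not necessarily identically distributed. -/
def jointLaw {Λ : Type u} {Y : ℕ → Type v} [∀ i, MeasurableSpace (Y i)]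
    (μ : ∀ i, Measure (Y i)) (p : ∀ i, Λ → Y i → ℝ≥0) (n : ℕ) (l : Λ) :
    Measure (∀ i : Fin n, Y i) :=
  Measure.pi (fun i : Fin n => marginalLaw μ p l i)

/-- The likelihood `∏ i, p_{l,i}(y_i)` of `n` observations. -/
def likelihood {Λ : Type u} {Y : ℕ → Type v} (p : ∀ i, Λ → Y i → ℝ≥0) (n : ℕ)
    (y : ∀ i : Fin n, Y i) (l : Λ) : ℝ≥0∞ :=
  ∏ i : Fin n, (p i l (y i) : ℝ≥0∞)

/-- The posterior distribution given by Bayes' formula: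
`Π(A | y) = (∫_A ∏ p_{l,i}(y_i) dΠ(l)) / (∫ ∏ p_{l,i}(y_i) dΠ(l))`. It is a probability measure
whenever the denominator is positive and finite. -/
def posterior {Λ : Type u} [MeasurableSpace Λ] {Y : ℕ → Type v} (p : ∀ i, Λ → Y i → ℝ≥0)
    (Pi : Measure Λ) (n : ℕ) (y : ∀ i : Fin n, Y i) : Measure Λ :=
  (∫⁻ l, likelihood p n y l ∂Pi)⁻¹ • Pi.withDensity (likelihood p n y)

/-- The root average squared Hellinger semimetric: `d_n(l, l')` is the nonnegative root of
`(1/n) ∑ i < n, ∫ (√p_{l,i} - √p_{l',i})² dμ_i`. -/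
def hellingerDist {Λ : Type u} {Y : ℕ → Type v} [∀ i, MeasurableSpace (Y i)]
    (μ : ∀ i, Measure (Y i)) (p : ∀ i, Λ → Y i → ℝ≥0) (n : ℕ) (l l' : Λ) : ℝ :=
  Real.sqrt ((1 / (n : ℝ)) * ∑ i ∈ Finset.range n,
    ∫ y, (Real.sqrt (p i l y : ℝ) - Real.sqrt (p i l' y : ℝ)) ^ 2 ∂(μ i))

/-- The covering number `N(ε, A, d)`: the least number of `d`-balls of radius `ε` needed to cover
`A` (`⊤` if no finite number suffices). The centres need not lie in `A`. -/
def coveringNumber {Λ : Type u} (d : Λ → Λ → ℝ) (ε : ℝ) (A : Set Λ) : ℕ∞ :=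
  ⨅ (T : Set Λ) (_ : SetRel.IsCover {q : Λ × Λ | d q.1 q.2 ≤ ε} A T), T.encard

open scoped Classical in
/-- The variance of the log-likelihood ratio,
`V₂(P, Q) = ∫ |log (dP/dQ) - K(P, Q)|² dP`, where `K` is the Kullback-Leibler divergence; by
convention it is infinite when `K(P, Q)` is. -/
def klVariance {α : Type v} [MeasurableSpace α] (P Q : Measure α) : ℝ≥0∞ :=
  if InformationTheory.klDiv P Q = ⊤ then ⊤
  else ∫⁻ x, ENNReal.ofReal (|llr P Q x - (InformationTheory.klDiv P Q).toReal| ^ 2) ∂P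

/-- The Kullback-Leibler neighbourhood `B_n(P_{l₀}^{(n)}, ξ)`. -/
def klNeighborhood {Λ : Type u} {Y : ℕ → Type v} [∀ i, MeasurableSpace (Y i)]
    (μ : ∀ i, Measure (Y i)) (p : ∀ i, Λ → Y i → ℝ≥0) (n : ℕ) (l₀ : Λ) (ξ : ℝ) : Set Λ :=
  {l | InformationTheory.klDiv (jointLaw μ p n l₀) (jointLaw μ p n l)
        ≤ ENNReal.ofReal ((n : ℝ) * ξ ^ 2) ∧
      klVariance (jointLaw μ p n l₀) (jointLaw μ p n l) ≤ ENNReal.ofReal ((n : ℝ) * ξ ^ 2)}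

/-- `X n = O_{P n}(a n)`: for every `ε > 0` there is a constant `K > 0` such that, for all large
`n`, the probability under `P n` that `|X n| > K * a n` is at most `ε`. -/
def IsBigOInProb {Ω : ℕ → Type v} [∀ n, MeasurableSpace (Ω n)] (P : ∀ n, Measure (Ω n))
    (X : ∀ n, Ω n → ℝ) (a : ℕ → ℝ) : Prop :=
  ∀ ε : ℝ, 0 < ε → ∃ K : ℝ, 0 < K ∧
    ∀ᶠ n : ℕ in atTop, P n {ω | K * a n < |X n ω|} ≤ ENNReal.ofReal ε

end

end PosteriorContraction

namespace PosteriorContraction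

/-! Write x = nξ² and let L₀ be the likelihood at the truth. The posterior mass of the far set is a
ratio, and both parts are compared with L₀.

Denominator: on the Kullback-Leibler neighbourhood, Chebyshev's inequality (`measure_density_gt_le`)
shows that L₀ exceeds exp(2x) times the likelihood with probability at most 1/x. Averaging this over
the prior and applying Markov's inequality (`measure_evidence_lt_le`) bounds the evidence below by
exp(-(C+2)x) L₀ / 2, outside an event of probability at most 2/x.

Numerator: tests with errors exp(-(C+4)x) (`exists_test`) together with the small prior mass off the
sieve bound it above by exp(-(C+3)x) L₀, outside events of probability at most 3 exp(-x)
(`mul_measure_lt_numerator_le`, `setLIntegral_le_add_measure_compl`). The ratio is then at most 2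
exp(-x).

The tests sum the bounded scores (√f - √g)/(√f + √g). The exponential moment of one score is
controlled in Hellinger distance even when the sampling density is only near g (`sq_mul_exp_le`), so
one statistic handles a whole Hellinger ball, and a union over a minimal cover of the sieve costs
only a factor exp(x). -/

/-! ### Product measures and their densities -/

/-- **Tonelli's theorem** for a product of functions of the single coordinates. -/
theorem lintegral_pi_prod {n : ℕ} {E : Fin n → Type*} [∀ i, MeasurableSpace (E i)]
    (μ : ∀ i, Measure (E i)) [∀ i, SigmaFinite (μ i)]
    {f : ∀ i, E i → ℝ≥0∞} (hf : ∀ i, Measurable (f i)) :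
    ∫⁻ x, ∏ i, f i (x i) ∂(Measure.pi μ) = ∏ i, ∫⁻ x, f i x ∂(μ i) := by
  induction n with
  | zero => simp
  | succ n ih =>
    calc
      _ = ∫⁻ x : E 0 × ((i : Fin n) → E (Fin.succ i)),
            f 0 x.1 * ∏ i : Fin n, f (Fin.succ i) (x.2 i)
            ∂((μ 0).prod (Measure.pi (fun i ↦ μ i.succ))) := by
          rw [← ((measurePreserving_piFinSuccAbove μ 0).symm).lintegral_comp_emb
            (MeasurableEquiv.measurableEmbedding _)]
          simp_rw [MeasurableEquiv.piFinSuccAbove_symm_apply, Fin.insertNthEquiv,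
            Fin.prod_univ_succ, Fin.insertNth_zero, Equiv.coe_fn_mk, Fin.cons_succ,
            Fin.zero_succAbove, Fin.cons_zero]
          rfl
      _ = (∫⁻ x, f 0 x ∂μ 0)
            * ∏ i : Fin n, ∫⁻ (x : E (Fin.succ i)), f (Fin.succ i) x ∂(μ i.succ) := by
          rw [← ih (fun i => μ i.succ) (fun i => hf i.succ), ← lintegral_prod_mul]
          · exact (hf 0).aemeasurable
          · exact (Finset.measurable_fun_prod _
              fun i _ => (hf i.succ).comp (measurable_pi_apply i)).aemeasurable
      _ = ∏ i, ∫⁻ x, f i x ∂(μ i) := by rw [Fin.prod_univ_succ]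

/-- A product of measures with densities has the product of the densities as its density. -/
theorem pi_withDensity {n : ℕ} {E : Fin n → Type*} [∀ i, MeasurableSpace (E i)]
    (μ : ∀ i, Measure (E i)) [∀ i, SigmaFinite (μ i)]
    {f : ∀ i, E i → ℝ≥0∞} (hf : ∀ i, Measurable (f i))
    [∀ i, SigmaFinite ((μ i).withDensity (f i))] :
    Measure.pi (fun i => (μ i).withDensity (f i))
      = (Measure.pi μ).withDensity (fun x => ∏ i, f i (x i)) := by
  refine Measure.pi_eq fun s hs => ?_
  rw [withDensity_apply _ (MeasurableSet.univ_pi hs),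
    ← lintegral_indicator (MeasurableSet.univ_pi hs)]
  have h : ∀ x : ∀ i, E i, (Set.univ.pi s).indicator (fun x => ∏ i, f i (x i)) x
      = ∏ i, (s i).indicator (f i) (x i) := by
    intro x
    by_cases hx : x ∈ Set.univ.pi s
    · rw [Set.indicator_of_mem hx]
      exact Finset.prod_congr rfl fun i _ => (Set.indicator_of_mem (hx i (Set.mem_univ i)) _).symm
    · rw [Set.indicator_of_notMem hx]
      simp only [Set.mem_univ_pi, not_forall] at hx
      obtain ⟨i, hi⟩ := hx
      exact (Finset.prod_eq_zero (Finset.mem_univ i) (Set.indicator_of_notMem hi _)).symm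
  simp_rw [h]
  rw [lintegral_pi_prod μ fun i => (hf i).indicator (hs i)]
  exact Finset.prod_congr rfl fun i _ => by
    rw [lintegral_indicator (hs i), withDensity_apply _ (hs i)]

/-! ### Exponential moment of the score of a single observation -/

/-- Pointwise bound behind the exponential moment of the bounded test statistic. -/
theorem sq_mul_exp_le {u v w : ℝ} (hu : 0 ≤ u) (hv : 0 ≤ v) :
    w ^ 2 * Real.exp ((u - v) / (u + v) / 32)
      ≤ w ^ 2 + (u ^ 2 - v ^ 2) / 128 - (u - v) ^ 2 / 512 + (w - v) ^ 2 := by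
  obtain ⟨ψ, hψ⟩ : ∃ ψ, ψ = (u - v) / (u + v) := ⟨_, rfl⟩
  rw [← hψ]
  have hmul : ψ * (u + v) = u - v := by
    -- Where both roots vanish, the convention 0 / 0 = 0 makes the score zero.
    rcases eq_or_ne (u + v) 0 with h | h
    · have : u = 0 := by linarith
      have : v = 0 := by linarith
      simp [*]
    · rw [hψ, div_mul_cancel₀ _ h]
  have hψ1 : |ψ| ≤ 1 := by
    rw [hψ, abs_div, abs_of_nonneg (add_nonneg hu hv)]
    exact div_le_one_of_le₀ (abs_le.2 ⟨by linarith, by linarith⟩) (add_nonneg hu hv)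
  obtain ⟨h1, h2⟩ := abs_le.1 hψ1
  -- The scale 1/32 makes the second-order term cost (u - v)²/512, half of the first-order gain (u -
  -- v)²/256.
  have hexp : Real.exp (ψ / 32) ≤ 1 + ψ / 32 + (ψ / 32) ^ 2 := by
    have := Real.abs_exp_sub_one_sub_id_le (x := ψ / 32) (abs_le.2 ⟨by linarith, by linarith⟩)
    linarith [(abs_le.1 this).2]
  have hψ2 : ψ ^ 2 ≤ 1 := by nlinarith
  have hvψ : (v * ψ) ^ 2 ≤ (u - v) ^ 2 := by
    rw [← hmul, mul_pow, mul_pow, mul_comm]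
    exact mul_le_mul_of_nonneg_left (by nlinarith) (sq_nonneg ψ)
  have hlin : v ^ 2 * ψ ≤ (u ^ 2 - v ^ 2) / 4 - (u - v) ^ 2 / 4 := by
    have hpos : 0 ≤ v * ψ ^ 2 * (u + v) := by positivity
    have h3 : (u ^ 2 - v ^ 2) / 4 - (u - v) ^ 2 / 4 = ψ * (u + v) * v / 2 := by
      rw [hmul]; ring
    have h4 : ψ * (u + v) * v / 2 - v ^ 2 * ψ = v * ψ * (ψ * (u + v)) / 2 :=
      calc _ = v * ψ * (u - v) / 2 := by ring
        _ = _ := by rw [hmul]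
    nlinarith
  -- The weight 8 in this AM-GM step spends only half of the gain (u - v)²/4 from `hlin`.
  have hcross : 2 * (v * ψ) * (w - v) ≤ 8 * (w - v) ^ 2 + (u - v) ^ 2 / 8 := by
    nlinarith [sq_nonneg (v * ψ - 8 * (w - v))]
  have hfirst : w ^ 2 * ψ ≤ (u ^ 2 - v ^ 2) / 4 - (u - v) ^ 2 / 8 + 9 * (w - v) ^ 2 := by
    have : (w - v) ^ 2 * ψ ≤ (w - v) ^ 2 := mul_le_of_le_one_right (sq_nonneg _) h2
    nlinarith
  have hsecond : w ^ 2 * ψ ^ 2 ≤ 2 * (u - v) ^ 2 + 2 * (w - v) ^ 2 := by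
    have h5 : w ^ 2 ≤ 2 * v ^ 2 + 2 * (w - v) ^ 2 := by nlinarith [sq_nonneg (w - 2 * v)]
    have h6 : (w - v) ^ 2 * ψ ^ 2 ≤ (w - v) ^ 2 := mul_le_of_le_one_right (sq_nonneg _) hψ2
    nlinarith [mul_le_mul_of_nonneg_right h5 (sq_nonneg ψ)]
  have := mul_le_mul_of_nonneg_left hexp (sq_nonneg w)
  nlinarith [sq_nonneg (w - v)]

section Hellinger

variable {α : Type*} [MeasurableSpace α] {μ : Measure α} {f g s : α → ℝ≥0}

theorem integrable_density (hf : Measurable f) (h : ∫⁻ y, (f y : ℝ≥0∞) ∂μ = 1) :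
    Integrable (fun y => (f y : ℝ)) μ :=
  ⟨hf.coe_nnreal_real.aestronglyMeasurable, by
    simp [HasFiniteIntegral, Real.enorm_eq_ofReal, h]⟩

theorem integral_density (hf : Measurable f) (h : ∫⁻ y, (f y : ℝ≥0∞) ∂μ = 1) :
    ∫ y, (f y : ℝ) ∂μ = 1 := by
  rw [integral_eq_lintegral_of_nonneg_ae (ae_of_all _ fun y => (f y).coe_nonneg)
    hf.coe_nnreal_real.aestronglyMeasurable]
  simp [h]

theorem integrable_sqrt_sub_sqrt_sq (hf : Measurable f) (hg : Measurable g)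
    (hf1 : ∫⁻ y, (f y : ℝ≥0∞) ∂μ = 1) (hg1 : ∫⁻ y, (g y : ℝ≥0∞) ∂μ = 1) :
    Integrable (fun y => (Real.sqrt (f y) - Real.sqrt (g y)) ^ 2) μ := by
  refine ((integrable_density hf hf1).add (integrable_density hg hg1)).mono'
    (by fun_prop) (ae_of_all _ fun y => ?_)
  rw [Real.norm_of_nonneg (sq_nonneg _)]
  have h1 := Real.sq_sqrt (f y).coe_nonneg
  have h2 := Real.sq_sqrt (g y).coe_nonneg
  have := mul_nonneg (Real.sqrt_nonneg (f y)) (Real.sqrt_nonneg (g y))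
  simp only [Pi.add_apply]
  nlinarith

/-- The score `(√f - √g) / (√f + √g)`, large where `f` dominates `g` and bounded by one. -/
noncomputable def hellingerScore (f g : α → ℝ≥0) (y : α) : ℝ :=
  (Real.sqrt (f y) - Real.sqrt (g y)) / (Real.sqrt (f y) + Real.sqrt (g y))

theorem measurable_hellingerScore (hf : Measurable f) (hg : Measurable g) :
    Measurable (hellingerScore f g) := by
  unfold hellingerScore
  fun_prop

omit [MeasurableSpace α] in
theorem hellingerScore_swap (y : α) : hellingerScore g f y = -hellingerScore f g y := by
  unfold hellingerScore
  rw [← neg_div, neg_sub, add_comm]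

/-- Integrate `sq_mul_exp_le` at the square roots of the densities. The term in `f - g` disappears
because both have mass one, and 1 + t ≤ exp t gives a form that multiplies over independent
observations. Allowing a sampling density `s` different from `g` is what makes the test robust. -/
theorem lintegral_density_mul_exp_score_le (hs : Measurable s) (hf : Measurable f)
    (hg : Measurable g) (hs1 : ∫⁻ y, (s y : ℝ≥0∞) ∂μ = 1) (hf1 : ∫⁻ y, (f y : ℝ≥0∞) ∂μ = 1)
    (hg1 : ∫⁻ y, (g y : ℝ≥0∞) ∂μ = 1) :
    ∫⁻ y, (s y : ℝ≥0∞) * ENNReal.ofReal (Real.exp (hellingerScore f g y / 32)) ∂μ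
      ≤ ENNReal.ofReal (Real.exp
        (∫ y, (Real.sqrt (s y) - Real.sqrt (g y)) ^ 2 ∂μ
          - (∫ y, (Real.sqrt (f y) - Real.sqrt (g y)) ^ 2 ∂μ) / 512)) := by
  have is := integrable_density hs hs1
  have if' := integrable_density hf hf1
  have ig := integrable_density hg hg1
  have ifg := integrable_sqrt_sub_sqrt_sq hf hg hf1 hg1
  have isg := integrable_sqrt_sub_sqrt_sq hs hg hs1 hg1
  have hle : ∀ y, (s y : ℝ) * Real.exp (hellingerScore f g y / 32)
      ≤ (s y : ℝ) + ((f y : ℝ) - g y) / 128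
        - (Real.sqrt (f y) - Real.sqrt (g y)) ^ 2 / 512
        + (Real.sqrt (s y) - Real.sqrt (g y)) ^ 2 := by
    intro y
    have := sq_mul_exp_le (w := Real.sqrt (s y)) (Real.sqrt_nonneg (f y)) (Real.sqrt_nonneg (g y))
    rwa [Real.sq_sqrt (s y).coe_nonneg, Real.sq_sqrt (f y).coe_nonneg, Real.sq_sqrt (g y).coe_nonneg] at this
  have iA := is.add ((if'.sub ig).div_const 128)
  have iB := iA.sub (ifg.div_const 512)
  have iC := iB.add isg
  calc
    _ ≤ ∫⁻ y, ENNReal.ofReal ((s y : ℝ) + ((f y : ℝ) - g y) / 128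
        - (Real.sqrt (f y) - Real.sqrt (g y)) ^ 2 / 512
        + (Real.sqrt (s y) - Real.sqrt (g y)) ^ 2) ∂μ := by
      refine lintegral_mono fun y => ?_
      rw [← ENNReal.ofReal_coe_nnreal, ← ENNReal.ofReal_mul (s y).coe_nonneg]
      exact ENNReal.ofReal_le_ofReal (hle y)
    _ = ENNReal.ofReal (∫ y, ((s y : ℝ) + ((f y : ℝ) - g y) / 128
        - (Real.sqrt (f y) - Real.sqrt (g y)) ^ 2 / 512
        + (Real.sqrt (s y) - Real.sqrt (g y)) ^ 2) ∂μ) :=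
      (ofReal_integral_eq_lintegral_ofReal iC (ae_of_all _ fun y =>
        (mul_nonneg (s y).coe_nonneg (Real.exp_pos _).le).trans (hle y))).symm
    _ ≤ _ := by
      refine ENNReal.ofReal_le_ofReal ?_
      have e1 := integral_add iB isg
      have e2 := integral_sub iA (ifg.div_const 512)
      have e3 := integral_add is ((if'.sub ig).div_const 128)
      have e4 := integral_sub if' ig
      have e5 := integral_div 128 (fun y => (f y : ℝ) - g y) (μ := μ)
      have e6 := integral_div 512 (fun y => (Real.sqrt (f y) - Real.sqrt (g y)) ^ 2) (μ := μ)
      simp only [Pi.add_apply, Pi.sub_apply] at e1 e2 e3 e4 e5 e6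
      rw [e1, e2, e3, e5, e6, e4, integral_density hs hs1, integral_density hf hf1,
        integral_density hg hg1]
      refine le_trans (le_of_eq ?_) (Real.add_one_le_exp _)
      ring

end Hellinger

/-! ### Joint laws and the averaged Hellinger semimetric -/

section Model

variable {Λ : Type*} {Y : ℕ → Type*} [∀ i, MeasurableSpace (Y i)]
  {μ : ∀ i, Measure (Y i)} {p : ∀ i, Λ → Y i → ℝ≥0}

theorem isProbabilityMeasure_marginalLaw (hp_one : ∀ i l, ∫⁻ y, (p i l y : ℝ≥0∞) ∂(μ i) = 1)
    (l : Λ) (i : ℕ) : IsProbabilityMeasure (marginalLaw μ p l i) :=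
  ⟨by rw [marginalLaw, withDensity_apply _ MeasurableSet.univ, setLIntegral_univ, hp_one]⟩

theorem isProbabilityMeasure_jointLaw (hp_one : ∀ i l, ∫⁻ y, (p i l y : ℝ≥0∞) ∂(μ i) = 1)
    (n : ℕ) (l : Λ) : IsProbabilityMeasure (jointLaw μ p n l) := by
  have := isProbabilityMeasure_marginalLaw hp_one l
  unfold jointLaw
  infer_instance

theorem jointLaw_eq_withDensity [∀ i, SigmaFinite (μ i)] (hp : ∀ i l, Measurable (p i l))
    (hp_one : ∀ i l, ∫⁻ y, (p i l y : ℝ≥0∞) ∂(μ i) = 1) (n : ℕ) (l : Λ) :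
    jointLaw μ p n l
      = (Measure.pi fun i : Fin n => μ i).withDensity fun y => likelihood p n y l := by
  have := isProbabilityMeasure_marginalLaw hp_one l
  have hsf : ∀ i : Fin n, SigmaFinite ((μ i).withDensity fun y => (p i l y : ℝ≥0∞)) :=
    fun i => inferInstanceAs (SigmaFinite (marginalLaw μ p l i))
  exact pi_withDensity (fun i : Fin n => μ i) fun i => (hp i l).coe_nnreal_ennreal

omit [∀ i, MeasurableSpace (Y i)] in
theorem likelihood_ne_top (n : ℕ) (y : ∀ i : Fin n, Y i) (l : Λ) : likelihood p n y l ≠ ⊤ :=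
  ENNReal.prod_ne_top fun _ _ => ENNReal.coe_ne_top

theorem measurable_likelihood [MeasurableSpace Λ]
    (hp : ∀ i, Measurable (fun q : Λ × Y i => p i q.1 q.2)) (n : ℕ) :
    Measurable (fun q : Λ × (∀ i : Fin n, Y i) => likelihood p n q.2 q.1) :=
  Finset.measurable_fun_prod _ fun i _ => ((hp i).comp
    (measurable_fst.prodMk ((measurable_pi_apply i).comp measurable_snd))).coe_nnreal_ennreal

theorem natCast_mul_hellingerDist_sq (n : ℕ) (l l' : Λ) :
    (n : ℝ) * hellingerDist μ p n l l' ^ 2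
      = ∑ i : Fin n, ∫ y, (Real.sqrt (p i l y) - Real.sqrt (p i l' y)) ^ 2 ∂(μ i) := by
  rw [Fin.sum_univ_eq_sum_range
    (fun i => ∫ y, (Real.sqrt (p i l y) - Real.sqrt (p i l' y)) ^ 2 ∂(μ i)) n]
  rcases Nat.eq_zero_or_pos n with rfl | hn
  · simp
  · have hn' : (n : ℝ) ≠ 0 := by positivity
    rw [hellingerDist, Real.sq_sqrt, ← mul_assoc, mul_one_div_cancel hn', one_mul]
    exact mul_nonneg (by positivity) (Finset.sum_nonneg fun i _ =>
      integral_nonneg fun y => sq_nonneg _)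

theorem hellingerDist_nonneg (n : ℕ) (l l' : Λ) : 0 ≤ hellingerDist μ p n l l' :=
  Real.sqrt_nonneg _

theorem hellingerDist_self (n : ℕ) (l : Λ) : hellingerDist μ p n l l = 0 := by
  simp [hellingerDist]

theorem hellingerDist_comm (n : ℕ) (l l' : Λ) :
    hellingerDist μ p n l l' = hellingerDist μ p n l' l := by
  unfold hellingerDist
  congr 3 with i
  congr 1 with y
  ring

/-- Integrated form of (a - c)² ≤ 2(a - b)² + 2(b - c)². This weak triangle inequality replaces
Minkowski's and is the source of M²/2 - 1 in the tests. -/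
theorem natCast_mul_hellingerDist_sq_le (hp : ∀ i l, Measurable (p i l))
    (hp_one : ∀ i l, ∫⁻ y, (p i l y : ℝ≥0∞) ∂(μ i) = 1) (n : ℕ) (l l' l'' : Λ) :
    (n : ℝ) * hellingerDist μ p n l l'' ^ 2
      ≤ 2 * (n * hellingerDist μ p n l l' ^ 2) + 2 * (n * hellingerDist μ p n l' l'' ^ 2) := by
  simp only [natCast_mul_hellingerDist_sq]
  rw [Finset.mul_sum, Finset.mul_sum, ← Finset.sum_add_distrib]
  refine Finset.sum_le_sum fun i _ => ?_
  have hi : ∀ a b, Integrable (fun y => (Real.sqrt (p i a y) - Real.sqrt (p i b y)) ^ 2) (μ i) :=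
    fun a b => integrable_sqrt_sub_sqrt_sq (hp i a) (hp i b) (hp_one i a) (hp_one i b)
  rw [← integral_const_mul, ← integral_const_mul,
    ← integral_add ((hi l l').const_mul 2) ((hi l' l'').const_mul 2)]
  refine integral_mono (hi l l'') (((hi l l').const_mul 2).add ((hi l' l'').const_mul 2))
    fun y => ?_
  simp only
  nlinarith [sq_nonneg (Real.sqrt (p i l y) - 2 * Real.sqrt (p i l' y) + Real.sqrt (p i l'' y))]

/-! ### Tests from summed scores -/

/-- The sum of the scores of the single observations: the statistic of a robust test of `l₀`
against a Hellinger ball around `l₁`. -/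
noncomputable def totalScore (p : ∀ i, Λ → Y i → ℝ≥0) (n : ℕ) (l₀ l₁ : Λ)
    (y : ∀ i : Fin n, Y i) : ℝ :=
  ∑ i : Fin n, hellingerScore (p i l₀) (p i l₁) (y i)

theorem measurable_totalScore (hp : ∀ i l, Measurable (p i l)) (n : ℕ) (l₀ l₁ : Λ) :
    Measurable (totalScore p n l₀ l₁) :=
  Finset.measurable_fun_sum _ fun i _ =>
    (measurable_hellingerScore (hp i l₀) (hp i l₁)).comp (measurable_pi_apply i)

omit [∀ i, MeasurableSpace (Y i)] in
theorem totalScore_swap (n : ℕ) (l₀ l₁ : Λ) (y : ∀ i : Fin n, Y i) :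
    totalScore p n l₁ l₀ y = -totalScore p n l₀ l₁ y := by
  rw [totalScore, totalScore, ← Finset.sum_neg_distrib]
  exact Finset.sum_congr rfl fun i _ => hellingerScore_swap _

/-- Chernoff's bound at the threshold 0, factorised by independence. With `l` near `l₁` this is the
type II error of the test that rejects `l₀` when the score is negative. -/
theorem jointLaw_totalScore_nonneg_le [∀ i, SigmaFinite (μ i)] (hp : ∀ i l, Measurable (p i l))
    (hp_one : ∀ i l, ∫⁻ y, (p i l y : ℝ≥0∞) ∂(μ i) = 1) (n : ℕ) (l l₀ l₁ : Λ) :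
    jointLaw μ p n l {y | 0 ≤ totalScore p n l₀ l₁ y}
      ≤ ENNReal.ofReal (Real.exp (n * hellingerDist μ p n l l₁ ^ 2
          - n * hellingerDist μ p n l₀ l₁ ^ 2 / 512)) := by
  have hpl : ∀ i : Fin n, IsProbabilityMeasure (marginalLaw μ p l i) :=
    fun i => isProbabilityMeasure_marginalLaw hp_one l i
  have hm : ∀ i : Fin n, Measurable fun y : Y i =>
      ENNReal.ofReal (Real.exp (hellingerScore (p i l₀) (p i l₁) y / 32)) := fun i =>
    ((measurable_hellingerScore (hp i l₀) (hp i l₁)).div_const 32).exp.ennreal_ofReal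
  calc
    _ = ∫⁻ y, {y | 0 ≤ totalScore p n l₀ l₁ y}.indicator 1 y ∂(jointLaw μ p n l) :=
      (lintegral_indicator_one (measurableSet_le measurable_const
        (measurable_totalScore hp n l₀ l₁))).symm
    _ ≤ ∫⁻ y, ∏ i : Fin n, ENNReal.ofReal
          (Real.exp (hellingerScore (p i l₀) (p i l₁) (y i) / 32)) ∂(jointLaw μ p n l) := by
      refine lintegral_mono fun y => Set.indicator_apply_le' (fun hy => ?_) fun _ => bot_le
      rw [Pi.one_apply]
      rw [← ENNReal.ofReal_prod_of_nonneg fun i _ => (Real.exp_pos _).le, ← Real.exp_sum,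
        ← Finset.sum_div]
      exact ENNReal.one_le_ofReal.2 (Real.one_le_exp (div_nonneg hy (by norm_num)))
    _ = ∏ i : Fin n, ∫⁻ y, ENNReal.ofReal
          (Real.exp (hellingerScore (p i l₀) (p i l₁) y / 32)) ∂(marginalLaw μ p l i) :=
      lintegral_pi_prod (fun i : Fin n => marginalLaw μ p l i) hm
    _ ≤ ∏ i : Fin n, ENNReal.ofReal (Real.exp
        (∫ y, (Real.sqrt (p i l y) - Real.sqrt (p i l₁ y)) ^ 2 ∂(μ i)
          - (∫ y, (Real.sqrt (p i l₀ y) - Real.sqrt (p i l₁ y)) ^ 2 ∂(μ i)) / 512)) := by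
      refine Finset.prod_le_prod' fun i _ => ?_
      rw [marginalLaw, lintegral_withDensity_eq_lintegral_mul _ (hp i l).coe_nnreal_ennreal (hm i)]
      exact lintegral_density_mul_exp_score_le (hp i l) (hp i l₀) (hp i l₁) (hp_one i l)
        (hp_one i l₀) (hp_one i l₁)
    _ = _ := by
      rw [← ENNReal.ofReal_prod_of_nonneg fun i _ => (Real.exp_pos _).le, ← Real.exp_sum,
        Finset.sum_sub_distrib, ← Finset.sum_div, natCast_mul_hellingerDist_sq,
        natCast_mul_hellingerDist_sq]

/-- The type I error is the previous bound with the roles of `l₀` and `l₁` exchanged, since the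
score is antisymmetric; sampling then takes place exactly at the centre. -/
theorem jointLaw_totalScore_neg_le [∀ i, SigmaFinite (μ i)] (hp : ∀ i l, Measurable (p i l))
    (hp_one : ∀ i l, ∫⁻ y, (p i l y : ℝ≥0∞) ∂(μ i) = 1) (n : ℕ) (l₀ l₁ : Λ) :
    jointLaw μ p n l₀ {y | totalScore p n l₀ l₁ y < 0}
      ≤ ENNReal.ofReal (Real.exp (-(n * hellingerDist μ p n l₀ l₁ ^ 2 / 512))) := by
  have h := jointLaw_totalScore_nonneg_le hp hp_one n l₀ l₁ l₀
  rw [hellingerDist_self, hellingerDist_comm n l₁ l₀] at h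
  refine (measure_mono fun y (hy : totalScore p n l₀ l₁ y < 0) => ?_).trans (h.trans_eq ?_)
  · change 0 ≤ totalScore p n l₁ l₀ y
    rw [totalScore_swap]
    linarith
  · congr 2
    ring

omit [∀ i, MeasurableSpace (Y i)] in
theorem exists_finset_cover_of_log_coveringNumber_le {d : Λ → Λ → ℝ} {ε x : ℝ} {A : Set Λ}
    (h : ENNReal.log ((coveringNumber d ε A : ℕ∞) : ℝ≥0∞) ≤ (x : EReal)) :
    ∃ T : Finset Λ, (∀ l ∈ A, ∃ t ∈ T, d l t ≤ ε) ∧ (T.card : ℝ) ≤ Real.exp x := by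
  have hN : ((coveringNumber d ε A : ℕ∞) : ℝ≥0∞) ≤ ENNReal.ofReal (Real.exp x) := by
    rw [← ENNReal.log_le_log_iff, ENNReal.log_ofReal_of_pos (Real.exp_pos x), Real.log_exp]
    exact h
  -- An infimum in `ℕ∞` is attained. A minimiser that fails to cover would give the value `⊤`, which
  -- the entropy bound excludes.
  obtain ⟨T, hT⟩ := ENat.exists_eq_iInf (fun T : Set Λ =>
    ⨅ _ : SetRel.IsCover {q : Λ × Λ | d q.1 q.2 ≤ ε} A T, T.encard)
  have hNT : coveringNumber d ε A = _ := hT.symm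
  by_cases hc : SetRel.IsCover {q : Λ × Λ | d q.1 q.2 ≤ ε} A T
  · rw [iInf_pos hc] at hNT
    rw [hNT] at hN
    have hfin : T.Finite := by
      refine Set.encard_ne_top_iff.1 fun htop => ?_
      rw [htop] at hN
      simp at hN
    refine ⟨hfin.toFinset, fun l hl => ?_, ?_⟩
    · obtain ⟨t, ht, hlt⟩ := hc hl
      exact ⟨t, hfin.mem_toFinset.2 ht, hlt⟩
    · rw [hfin.encard_eq_coe_toFinset_card] at hN
      have := ENNReal.toReal_mono ENNReal.ofReal_ne_top hN
      rw [ENNReal.toReal_ofReal (Real.exp_pos x).le] at this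
      simpa using this
  · rw [iInf_neg hc] at hNT
    rw [hNT] at hN
    simp at hN

/-- Existence of tests of `l₀` against the points of a set of small entropy that are far from
`l₀`. -/
theorem exists_test [∀ i, SigmaFinite (μ i)] (hp : ∀ i l, Measurable (p i l))
    (hp_one : ∀ i l, ∫⁻ y, (p i l y : ℝ≥0∞) ∂(μ i) = 1) (n : ℕ) (l₀ : Λ) {A : Set Λ}
    {ξ K M : ℝ} (hξ : 0 < ξ) (hM : 0 ≤ M) (hKM : 512 * (K + 1) ≤ M ^ 2 / 2 - 1)
    (hA : ENNReal.log ((coveringNumber (hellingerDist μ p n) ξ A : ℕ∞) : ℝ≥0∞)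
      ≤ (((n : ℝ) * ξ ^ 2 : ℝ) : EReal)) :
    ∃ R : Set (∀ i : Fin n, Y i), MeasurableSet R ∧
      jointLaw μ p n l₀ R ≤ ENNReal.ofReal (Real.exp (-(K * (n * ξ ^ 2)))) ∧
      ∀ l ∈ A, M * ξ ≤ hellingerDist μ p n l l₀ →
        jointLaw μ p n l Rᶜ ≤ ENNReal.ofReal (Real.exp (-(K * (n * ξ ^ 2)))) := by
  classical
  obtain ⟨T, hT, hcard⟩ := exists_finset_cover_of_log_coveringNumber_le hA
  have hx : 0 ≤ (n : ℝ) * ξ ^ 2 := by positivity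
  have hKx := mul_le_mul_of_nonneg_right hKM hx
  -- Only centres far from `l₀` enter the rejection region; any centre within ξ of a far `l` is one
  -- of them.
  refine ⟨⋃ t ∈ T.filter fun t => (M ^ 2 / 2 - 1) * (n * ξ ^ 2)
      ≤ n * hellingerDist μ p n l₀ t ^ 2, {y | totalScore p n l₀ t y < 0}, ?_, ?_, ?_⟩
  · exact Finset.measurableSet_biUnion _ fun t _ =>
      measurableSet_lt (measurable_totalScore hp n l₀ t) measurable_const
  · calc
      _ ≤ ∑ t ∈ T.filter fun t => (M ^ 2 / 2 - 1) * (n * ξ ^ 2)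
            ≤ n * hellingerDist μ p n l₀ t ^ 2,
            jointLaw μ p n l₀ {y | totalScore p n l₀ t y < 0} :=
        measure_biUnion_finset_le _ _
      _ ≤ ∑ t ∈ T.filter fun t => (M ^ 2 / 2 - 1) * (n * ξ ^ 2)
            ≤ n * hellingerDist μ p n l₀ t ^ 2,
            ENNReal.ofReal (Real.exp (-((K + 1) * (n * ξ ^ 2)))) := by
        refine Finset.sum_le_sum fun t ht => (jointLaw_totalScore_neg_le hp hp_one n l₀ t).trans ?_
        have := (Finset.mem_filter.1 ht).2
        exact ENNReal.ofReal_le_ofReal (Real.exp_le_exp.2 (by linarith))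
      _ ≤ ENNReal.ofReal (Real.exp (n * ξ ^ 2))
            * ENNReal.ofReal (Real.exp (-((K + 1) * (n * ξ ^ 2)))) := by
        rw [Finset.sum_const, nsmul_eq_mul]
        gcongr
        rw [← ENNReal.ofReal_natCast]
        refine ENNReal.ofReal_le_ofReal (le_trans ?_ hcard)
        exact_mod_cast Finset.card_filter_le _ _
      _ = _ := by
        rw [← ENNReal.ofReal_mul (Real.exp_pos _).le, ← Real.exp_add]
        congr 2
        ring
  · intro l hl hfar
    obtain ⟨t, ht, hlt⟩ := hT l hl
    have h1 : (n : ℝ) * hellingerDist μ p n l t ^ 2 ≤ n * ξ ^ 2 := by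
      have := hellingerDist_nonneg (μ := μ) (p := p) n l t
      gcongr
    have h2 : M ^ 2 * ((n : ℝ) * ξ ^ 2) ≤ n * hellingerDist μ p n l l₀ ^ 2 := by
      have : (M * ξ) ^ 2 ≤ hellingerDist μ p n l l₀ ^ 2 := by gcongr
      nlinarith [mul_le_mul_of_nonneg_left this (Nat.cast_nonneg (α := ℝ) n)]
    have h3 := natCast_mul_hellingerDist_sq_le hp hp_one n l t l₀
    rw [hellingerDist_comm n t l₀] at h3
    have h4 : (M ^ 2 / 2 - 1) * (n * ξ ^ 2) ≤ n * hellingerDist μ p n l₀ t ^ 2 := by linarith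
    refine (measure_mono fun y hy => ?_).trans
      ((jointLaw_totalScore_nonneg_le hp hp_one n l l₀ t).trans ?_)
    · by_contra hneg
      have hneg' : totalScore p n l₀ t y < 0 := not_le.1 hneg
      exact hy (Set.mem_iUnion₂.2 ⟨t, Finset.mem_filter.2 ⟨ht, h4⟩, hneg'⟩)
    -- Being ξ away from the centre costs exp(x), which the extra 1 in K + 1 absorbs.
    · exact ENNReal.ofReal_le_ofReal (Real.exp_le_exp.2 (by linarith))

end Model

/-! ### Bounds for the evidence and the numerator -/

/-- Chebyshev's inequality for the log-likelihood ratio: if the Kullback-Leibler divergence and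
its variance are at most `x`, the density of `P` rarely exceeds `exp (2 x)` times that of `Q`. -/
theorem measure_density_gt_le {α : Type*} [MeasurableSpace α] {ν : Measure α} [SigmaFinite ν]
    {f g : α → ℝ≥0∞} (hf : Measurable f) (hg : Measurable g) (hf_top : ∀ y, f y ≠ ⊤)
    [IsProbabilityMeasure (ν.withDensity f)] [IsProbabilityMeasure (ν.withDensity g)]
    {x : ℝ} (hx : 0 < x)
    (hK : InformationTheory.klDiv (ν.withDensity f) (ν.withDensity g) ≤ ENNReal.ofReal x)
    (hV : klVariance (ν.withDensity f) (ν.withDensity g) ≤ ENNReal.ofReal x) :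
    ν.withDensity f {y | ENNReal.ofReal (Real.exp (2 * x)) * g y < f y}
      ≤ ENNReal.ofReal (1 / x) := by
  have hK_top : InformationTheory.klDiv (ν.withDensity f) (ν.withDensity g) ≠ ⊤ :=
    ne_top_of_le_ne_top ENNReal.ofReal_ne_top hK
  have hac : ν.withDensity f ≪ ν.withDensity g := by
    by_contra h
    exact hK_top (InformationTheory.klDiv_of_not_ac h)
  have hKx := ENNReal.toReal_le_of_le_ofReal hx.le hK
  rw [klVariance, if_neg hK_top] at hV
  set k := (InformationTheory.klDiv (ν.withDensity f) (ν.withDensity g)).toReal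
  have hfν : ν.withDensity f ≪ ν := withDensity_absolutelyContinuous ν f
  have hgν : ν.withDensity g ≪ ν := withDensity_absolutelyContinuous ν g
  have hg0 : ∀ᵐ y ∂(ν.withDensity g), g y ≠ 0 :=
    (ae_withDensity_iff hg).2 (ae_of_all _ fun _ h => h)
  -- A log-ratio of at least 2x exceeds its mean, which is at most x, by at least x.
  have hsub : ∀ᵐ y ∂(ν.withDensity f), ENNReal.ofReal (Real.exp (2 * x)) * g y < f y →
      ENNReal.ofReal (x ^ 2)
        ≤ ENNReal.ofReal (|llr (ν.withDensity f) (ν.withDensity g) y - k| ^ 2) := by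
    filter_upwards [hac (Measure.rnDeriv_eq_div hfν hgν), hac hg0,
      hfν (Measure.rnDeriv_withDensity ν hf), hfν (Measure.rnDeriv_withDensity ν hg)]
      with y h1 h2 h3 h4 hy
    have hdiv : ENNReal.ofReal (Real.exp (2 * x)) < f y / g y :=
      (ENNReal.lt_div_iff_mul_lt (Or.inl h2) (Or.inr (ENNReal.ofReal_pos.2 (Real.exp_pos _)).ne')).2 hy
    have hlog : 2 * x ≤ llr (ν.withDensity f) (ν.withDensity g) y := by
      rw [llr, h1, h3, h4, Real.le_log_iff_exp_le]
      · exact (ENNReal.ofReal_le_iff_le_toReal (ENNReal.div_ne_top (hf_top y) h2)).1 hdiv.le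
      · exact ENNReal.toReal_pos (ne_bot_of_gt hdiv) (ENNReal.div_ne_top (hf_top y) h2)
    refine ENNReal.ofReal_le_ofReal (pow_le_pow_left₀ hx.le (le_trans ?_ (le_abs_self _)) 2)
    linarith
  calc
    _ ≤ ν.withDensity f {y | ENNReal.ofReal (x ^ 2)
          ≤ ENNReal.ofReal (|llr (ν.withDensity f) (ν.withDensity g) y - k| ^ 2)} :=
      measure_mono_ae hsub
    _ ≤ (∫⁻ y, ENNReal.ofReal (|llr (ν.withDensity f) (ν.withDensity g) y - k| ^ 2)
          ∂(ν.withDensity f)) / ENNReal.ofReal (x ^ 2) := by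
      refine meas_ge_le_lintegral_div ?_ (by positivity) ENNReal.ofReal_ne_top
      have := measurable_llr (ν.withDensity f) (ν.withDensity g)
      exact (by fun_prop : Measurable fun y =>
        ENNReal.ofReal (|llr (ν.withDensity f) (ν.withDensity g) y - k| ^ 2)).aemeasurable
    _ ≤ ENNReal.ofReal x / ENNReal.ofReal (x ^ 2) := by gcongr
    _ = ENNReal.ofReal (1 / x) := by
      rw [← ENNReal.ofReal_div_of_pos (by positivity)]
      congr 1
      field_simp

section Bayes

variable {Λ Ω : Type*} [MeasurableSpace Λ] [MeasurableSpace Ω] {ν : Measure Ω} [SFinite ν]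
  {f : Λ → Ω → ℝ≥0∞} {Q : Measure Λ}

/-- Lower bound for the evidence `∫⁻ l, f l y ∂Q` in terms of the true density `f₀`. -/
theorem measure_evidence_lt_le [IsFiniteMeasure Q] (hf : Measurable (Function.uncurry f))
    {f₀ : Ω → ℝ≥0∞} (hf₀ : Measurable f₀) {c δ : ℝ≥0∞} {G : Set Λ}
    (hQG : Q G ≠ 0)
    (h : ∀ l ∈ G, ν.withDensity f₀ {y | c * f l y < f₀ y} ≤ δ) :
    ν.withDensity f₀ {y | 2 * (c * ∫⁻ l, f l y ∂Q) < Q G * f₀ y} ≤ 2 * δ := by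
  have hf' : ∀ y, Measurable fun l => f l y := fun y => hf.comp measurable_prodMk_right
  have hE : MeasurableSet {q : Λ × Ω | c * f q.1 q.2 < f₀ q.2} :=
    measurableSet_lt (hf.const_mul c) (hf₀.comp measurable_snd)
  have hEy : ∀ y, MeasurableSet {l | c * f l y < f₀ y} := fun y =>
    measurableSet_lt ((hf' y).const_mul c) measurable_const
  set P := ν.withDensity f₀
  -- Tonelli is applied to the restricted prior, so `G` itself need not be measurable.
  have hprod : ∫⁻ y, Q.restrict G {l | c * f l y < f₀ y} ∂P ≤ δ * Q G := by
    calc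
      _ = ((Q.restrict G).prod P) {q : Λ × Ω | c * f q.1 q.2 < f₀ q.2} :=
        (Measure.prod_apply_symm hE).symm
      _ = ∫⁻ l in G, P {y | c * f l y < f₀ y} ∂Q := Measure.prod_apply hE
      _ ≤ ∫⁻ _ in G, δ ∂Q := setLIntegral_mono measurable_const h
      _ = δ * Q G := setLIntegral_const _ _
  have hsub : {y | 2 * (c * ∫⁻ l, f l y ∂Q) < Q G * f₀ y}
      ⊆ {y | Q G / 2 ≤ Q.restrict G {l | c * f l y < f₀ y}} := by
    intro y hy
    by_contra hlt
    rw [Set.mem_ofPred_eq, not_le, Measure.restrict_apply (hEy y), Set.inter_comm] at hlt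
    -- If the bad parameters fill less than half of `G`, the good half alone bounds the evidence
    -- from below.
    have hhalf : Q G / 2 ≤ Q (G \ {l | c * f l y < f₀ y}) := by
      have hadd := measure_inter_add_sdiff (μ := Q) G (hEy y)
      by_contra hlt'
      have := ENNReal.add_lt_add hlt (not_le.1 hlt')
      rw [hadd, ENNReal.add_halves] at this
      exact lt_irrefl _ this
    have hy' : 2 * (c * ∫⁻ l, f l y ∂Q) < Q G * f₀ y := hy
    refine absurd hy' (not_lt.2 ?_)
    calc
      Q G * f₀ y = 2 * (f₀ y * (Q G / 2)) := by
        rw [mul_left_comm, ENNReal.mul_div_cancel two_ne_zero ENNReal.ofNat_ne_top, mul_comm]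
      _ ≤ 2 * (f₀ y * Q (G \ {l | c * f l y < f₀ y})) := by gcongr
      _ = 2 * ∫⁻ _ in G \ {l | c * f l y < f₀ y}, f₀ y ∂Q := by rw [setLIntegral_const]
      _ ≤ 2 * ∫⁻ l in G \ {l | c * f l y < f₀ y}, c * f l y ∂Q := by
        gcongr 2 * ?_
        exact setLIntegral_mono ((hf' y).const_mul c) fun l hl => not_lt.1 hl.2
      _ ≤ 2 * ∫⁻ l, c * f l y ∂Q := by
        gcongr
        exact Measure.restrict_le_self
      _ = 2 * (c * ∫⁻ l, f l y ∂Q) := by rw [lintegral_const_mul _ (hf' y)]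
  calc
    _ ≤ P {y | Q G / 2 ≤ Q.restrict G {l | c * f l y < f₀ y}} := measure_mono hsub
    _ ≤ (∫⁻ y, Q.restrict G {l | c * f l y < f₀ y} ∂P) / (Q G / 2) :=
      meas_ge_le_lintegral_div (measurable_measure_prodMk_right hE).aemeasurable
        (ENNReal.div_pos hQG ENNReal.ofNat_ne_top).ne'
        (ENNReal.div_ne_top (measure_ne_top _ _) two_ne_zero)
    _ ≤ (δ * Q G) / (Q G / 2) := by gcongr
    _ = 2 * δ := by
      have hhalf : Q G / 2 ≠ 0 := (ENNReal.div_pos hQG ENNReal.ofNat_ne_top).ne'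
      have hhalf_top : Q G / 2 ≠ ⊤ := ENNReal.div_ne_top (measure_ne_top _ _) two_ne_zero
      have h2 : δ * Q G = 2 * δ * (Q G / 2) := by
        rw [mul_comm 2 δ, mul_assoc, ENNReal.mul_div_cancel two_ne_zero ENNReal.ofNat_ne_top]
      rw [h2, ENNReal.mul_div_cancel_right hhalf hhalf_top]

/-- Upper bound for the numerator `∫⁻ l in U, f l y ∂Q` of the posterior off the rejection region
of a test. -/
theorem mul_measure_lt_numerator_le [SFinite Q] (hf : Measurable (Function.uncurry f))
    {f₀ : Ω → ℝ≥0∞} (hf₀ : Measurable f₀) {τ : ℝ≥0∞} {R : Set Ω} (hR : MeasurableSet R)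
    (U : Set Λ) :
    τ * ν.withDensity f₀ (Rᶜ ∩ {y | τ * f₀ y < ∫⁻ l in U, f l y ∂Q})
      ≤ ∫⁻ l in U, ν.withDensity (f l) Rᶜ ∂Q := by
  have hN : Measurable fun y => ∫⁻ l in U, f l y ∂Q := hf.lintegral_prod_left'
  have hS : MeasurableSet (Rᶜ ∩ {y | τ * f₀ y < ∫⁻ l in U, f l y ∂Q}) :=
    hR.compl.inter (measurableSet_lt (hf₀.const_mul τ) hN)
  calc
    _ = ∫⁻ y in Rᶜ ∩ {y | τ * f₀ y < ∫⁻ l in U, f l y ∂Q}, τ * f₀ y ∂ν := by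
      rw [withDensity_apply _ hS, lintegral_const_mul _ hf₀]
    _ ≤ ∫⁻ y in Rᶜ ∩ {y | τ * f₀ y < ∫⁻ l in U, f l y ∂Q}, ∫⁻ l in U, f l y ∂Q ∂ν :=
      setLIntegral_mono hN fun y hy => hy.2.le
    _ ≤ ∫⁻ y in Rᶜ, ∫⁻ l in U, f l y ∂Q ∂ν := lintegral_mono_set Set.inter_subset_left
    _ = ∫⁻ l in U, ∫⁻ y in Rᶜ, f l y ∂ν ∂Q := by
      rw [lintegral_lintegral_swap]
      exact (hf.comp measurable_swap).aemeasurable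
    _ = _ := lintegral_congr fun l => (withDensity_apply _ hR.compl).symm

/-- An integral over `U` of a function bounded by one is controlled by its bound on a sieve `F`
and by the mass outside the sieve. -/
theorem setLIntegral_le_add_measure_compl [IsProbabilityMeasure Q] {g : Λ → ℝ≥0∞} {U F : Set Λ}
    (hF : MeasurableSet F) {a : ℝ≥0∞} (ha : ∀ l ∈ F, l ∈ U → g l ≤ a) (hg : ∀ l, g l ≤ 1) :
    ∫⁻ l in U, g l ∂Q ≤ a + Q Fᶜ := by
  rw [← lintegral_inter_add_sdiff _ _ hF]
  gcongr
  · calc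
      _ ≤ ∫⁻ _ in U ∩ F, a ∂Q := setLIntegral_mono measurable_const fun l hl => ha l hl.2 hl.1
      _ ≤ a := by
        rw [setLIntegral_const]
        exact mul_le_of_le_one_right' prob_le_one
  · calc
      _ ≤ ∫⁻ _ in U \ F, 1 ∂Q := setLIntegral_mono measurable_const fun l _ => hg l
      _ ≤ Q Fᶜ := by
        rw [setLIntegral_one]
        exact measure_mono fun l hl => hl.2

end Bayes

/-! ### Posterior contraction at a fixed sample size -/

section Posterior

variable {Λ : Type*} [MeasurableSpace Λ] {Y : ℕ → Type*} [∀ i, MeasurableSpace (Y i)]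
  {μ : ∀ i, Measure (Y i)} [∀ i, SigmaFinite (μ i)] {p : ∀ i, Λ → Y i → ℝ≥0}

omit [∀ i, MeasurableSpace (Y i)] in
/-- The posterior mass of `U` where the evidence is large and the numerator is small. -/
theorem posterior_le {Q : Measure Λ} [SFinite Q] {n : ℕ} {y : ∀ i : Fin n, Y i} {U : Set Λ}
    {l₀ : Λ} {a b c x : ℝ} (hy : likelihood p n y l₀ ≠ 0)
    (hQ : ENNReal.ofReal (Real.exp (-a)) * likelihood p n y l₀
      ≤ 2 * (ENNReal.ofReal (Real.exp b) * ∫⁻ l, likelihood p n y l ∂Q))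
    (hN : ∫⁻ l in U, likelihood p n y l ∂Q
      ≤ ENNReal.ofReal (Real.exp (-c)) * likelihood p n y l₀) (habc : a + b + x ≤ c) :
    posterior p Q n y U ≤ ENNReal.ofReal (2 * Real.exp (-x)) := by
  set D := ∫⁻ l, likelihood p n y l ∂Q
  have hexp : ∀ t : ℝ, ENNReal.ofReal (Real.exp t) ≠ 0 := fun t =>
    (ENNReal.ofReal_pos.2 (Real.exp_pos t)).ne'
  have hND : ∫⁻ l in U, likelihood p n y l ∂Q ≤ ENNReal.ofReal (2 * Real.exp (-x)) * D := by
    calc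
      _ ≤ ENNReal.ofReal (Real.exp (-c)) * likelihood p n y l₀ := hN
      _ ≤ ENNReal.ofReal (Real.exp (-b - x) * Real.exp (-a)) * likelihood p n y l₀ := by
        gcongr
        rw [← Real.exp_add]
        exact Real.exp_le_exp.2 (by linarith)
      _ = ENNReal.ofReal (Real.exp (-b - x))
            * (ENNReal.ofReal (Real.exp (-a)) * likelihood p n y l₀) := by
        rw [ENNReal.ofReal_mul (Real.exp_pos _).le, mul_assoc]
      _ ≤ ENNReal.ofReal (Real.exp (-b - x)) * (2 * (ENNReal.ofReal (Real.exp b) * D)) := by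
        gcongr
      _ = ENNReal.ofReal (Real.exp (-b - x)) * ENNReal.ofReal 2 * ENNReal.ofReal (Real.exp b)
            * D := by
        rw [ENNReal.ofReal_ofNat]
        ring
      _ = ENNReal.ofReal (2 * Real.exp (-x)) * D := by
        rw [← ENNReal.ofReal_mul (Real.exp_pos _).le, ← ENNReal.ofReal_mul (by positivity)]
        congr 2
        rw [mul_right_comm, ← Real.exp_add, mul_comm]
        congr 2
        ring
  have hD : D ≠ 0 := by
    intro h0
    rw [h0, mul_zero, mul_zero, nonpos_iff_eq_zero, mul_eq_zero] at hQ
    exact hQ.elim (hexp _) hy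
  rw [posterior, Measure.smul_apply, smul_eq_mul, withDensity_apply' _ U]
  calc
    _ ≤ D⁻¹ * (ENNReal.ofReal (2 * Real.exp (-x)) * D) := by gcongr
    _ = ENNReal.ofReal (2 * Real.exp (-x)) * (D⁻¹ * D) := by ring
    _ ≤ ENNReal.ofReal (2 * Real.exp (-x)) * 1 := by
      gcongr
      -- This also holds for `D = ⊤`, where the product is zero, so the evidence need not be shown
      -- finite.
      exact ENNReal.inv_mul_le_one D
    _ = _ := mul_one _

/-- The evidence is bounded below with high probability if the prior charges the Kullback-Leibler
neighbourhood of the truth. -/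
theorem jointLaw_evidence_lt_le
    (hp : ∀ i, Measurable (fun q : Λ × Y i => p i q.1 q.2))
    (hp_one : ∀ i l, ∫⁻ y, (p i l y : ℝ≥0∞) ∂(μ i) = 1) (l₀ : Λ) {n : ℕ} {Q : Measure Λ}
    [IsProbabilityMeasure Q] {ξ a : ℝ} (hx : 0 < (n : ℝ) * ξ ^ 2)
    (hQ : ENNReal.ofReal (Real.exp (-a)) ≤ Q (klNeighborhood μ p n l₀ ξ)) :
    jointLaw μ p n l₀ {y | 2 * (ENNReal.ofReal (Real.exp (2 * (n * ξ ^ 2)))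
        * ∫⁻ l, likelihood p n y l ∂Q) < ENNReal.ofReal (Real.exp (-a)) * likelihood p n y l₀}
      ≤ ENNReal.ofReal (2 / (n * ξ ^ 2)) := by
  have hpl : ∀ i l, Measurable (p i l) := fun i l => (hp i).comp measurable_prodMk_left
  have hlik := measurable_likelihood hp n
  have hlik' : ∀ l, Measurable fun y : ∀ i : Fin n, Y i => likelihood p n y l := fun l =>
    hlik.comp measurable_prodMk_left
  have hprob := isProbabilityMeasure_jointLaw hp_one n (p := p)
  have hlaw := jointLaw_eq_withDensity hpl hp_one n
  set c := ENNReal.ofReal (Real.exp (2 * (n * ξ ^ 2)))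
  have h2 := measure_evidence_lt_le (ν := Measure.pi fun i : Fin n => μ i) (Q := Q)
    (f := fun l y => likelihood p n y l) hlik (hlik' l₀)
    (c := c) (δ := ENNReal.ofReal (1 / (n * ξ ^ 2))) (G := klNeighborhood μ p n l₀ ξ)
    ((ENNReal.ofReal_pos.2 (Real.exp_pos _)).trans_le hQ).ne' (by
      rintro l ⟨hK, hV⟩
      have h0 := hprob l₀
      have h1 := hprob l
      rw [hlaw] at h0 h1
      rw [hlaw, hlaw] at hK hV
      exact measure_density_gt_le (hlik' l₀) (hlik' l) (fun y => likelihood_ne_top n y l₀)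
        hx hK hV)
  rw [← hlaw] at h2
  refine (measure_mono fun y hy => ?_).trans (h2.trans_eq ?_)
  · have hy' : 2 * (c * ∫⁻ l, likelihood p n y l ∂Q)
        < ENNReal.ofReal (Real.exp (-a)) * likelihood p n y l₀ := hy
    exact hy'.trans_le (by gcongr)
  · rw [← ENNReal.ofReal_ofNat, ← ENNReal.ofReal_mul (by norm_num), mul_one_div]

/-- Nonasymptotic posterior contraction at a fixed sample size. -/
theorem jointLaw_posterior_gt_le
    (hp : ∀ i, Measurable (fun q : Λ × Y i => p i q.1 q.2))
    (hp_one : ∀ i l, ∫⁻ y, (p i l y : ℝ≥0∞) ∂(μ i) = 1) (l₀ : Λ) {n : ℕ} {Q : Measure Λ}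
    [IsProbabilityMeasure Q] {ξ C M : ℝ} {F : Set Λ} (hn : 0 < (n : ℝ)) (hξ : 0 < ξ)
    (hF : MeasurableSet F) (hC : 0 < C) (hM : 0 ≤ M) (hCM : 512 * (C + 5) ≤ M ^ 2 / 2 - 1)
    (ha : Q Fᶜ ≤ ENNReal.ofReal (Real.exp (-((n : ℝ) * ξ ^ 2 * (C + 4)))))
    (hb : ENNReal.log ((coveringNumber (hellingerDist μ p n) ξ F : ℕ∞) : ℝ≥0∞)
      ≤ (((n : ℝ) * ξ ^ 2 : ℝ) : EReal))
    (hc : ENNReal.ofReal (Real.exp (-(C * (n : ℝ) * ξ ^ 2))) ≤ Q (klNeighborhood μ p n l₀ ξ)) :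
    jointLaw μ p n l₀ {y | 2 * Real.exp (-(n * ξ ^ 2))
        < (posterior p Q n y).real {l | M * ξ ≤ hellingerDist μ p n l l₀}}
      ≤ ENNReal.ofReal (3 * Real.exp (-(n * ξ ^ 2)) + 2 / (n * ξ ^ 2)) := by
  have hpl : ∀ i l, Measurable (p i l) := fun i l => (hp i).comp measurable_prodMk_left
  have hlik := measurable_likelihood hp n
  have hlik' : ∀ l, Measurable fun y : ∀ i : Fin n, Y i => likelihood p n y l := fun l =>
    hlik.comp measurable_prodMk_left
  have hprob := isProbabilityMeasure_jointLaw hp_one n (p := p)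
  have hlaw := jointLaw_eq_withDensity hpl hp_one n
  have hx : 0 < (n : ℝ) * ξ ^ 2 := by positivity
  obtain ⟨R, hR, hR0, hR1⟩ := exists_test hpl hp_one n l₀ (K := C + 4) hξ hM (by linarith) hb
  have hE := jointLaw_evidence_lt_le hp hp_one l₀ hx hc
  set x := (n : ℝ) * ξ ^ 2
  set U := {l | M * ξ ≤ hellingerDist μ p n l l₀}
  set E := {y | 2 * (ENNReal.ofReal (Real.exp (2 * x)) * ∫⁻ l, likelihood p n y l ∂Q)
    < ENNReal.ofReal (Real.exp (-(C * n * ξ ^ 2))) * likelihood p n y l₀}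
  -- The level C + 3 lies one below the exponent C + 4 of the tests and the sieve, and one above the
  -- exponent C + 2 lost in the evidence; each gap yields a factor exp(-x).
  set S := Rᶜ ∩ {y | ENNReal.ofReal (Real.exp (-((C + 3) * x))) * likelihood p n y l₀
    < ∫⁻ l in U, likelihood p n y l ∂Q}
  set Z := {y : ∀ i : Fin n, Y i | likelihood p n y l₀ = 0}
  have hZ : jointLaw μ p n l₀ Z = 0 := by
    have : ∀ᵐ y ∂(jointLaw μ p n l₀), likelihood p n y l₀ ≠ 0 := by
      rw [hlaw]
      exact (ae_withDensity_iff (hlik' l₀)).2 (ae_of_all _ fun _ h => h)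
    simpa using (ae_iff.1 this)
  have hS : jointLaw μ p n l₀ S ≤ ENNReal.ofReal (2 * Real.exp (-x)) := by
    have h1 := mul_measure_lt_numerator_le (ν := Measure.pi fun i : Fin n => μ i) (Q := Q)
      (f := fun l y => likelihood p n y l) hlik (hlik' l₀)
      (τ := ENNReal.ofReal (Real.exp (-((C + 3) * x)))) hR U
    simp_rw [← hlaw] at h1
    have h2 := setLIntegral_le_add_measure_compl (Q := Q) (U := U)
      (g := fun l => jointLaw μ p n l Rᶜ) hF (fun l hl hlU => hR1 l hl hlU) fun l => prob_le_one
    have h3 := h1.trans (h2.trans (add_le_add_right ha _))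
    calc
      _ = ENNReal.ofReal (Real.exp ((C + 3) * x))
            * (ENNReal.ofReal (Real.exp (-((C + 3) * x))) * jointLaw μ p n l₀ S) := by
        rw [← mul_assoc, ← ENNReal.ofReal_mul (Real.exp_pos _).le, ← Real.exp_add,
          add_neg_cancel, Real.exp_zero, ENNReal.ofReal_one, one_mul]
      _ ≤ ENNReal.ofReal (Real.exp ((C + 3) * x)) * (ENNReal.ofReal (Real.exp (-((C + 4) * x)))
            + ENNReal.ofReal (Real.exp (-(x * (C + 4))))) := by gcongr
      _ = _ := by
        rw [mul_comm x, ← two_mul, ← ENNReal.ofReal_ofNat, ← ENNReal.ofReal_mul (by norm_num),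
          ← ENNReal.ofReal_mul (Real.exp_pos _).le, mul_left_comm, ← Real.exp_add]
        congr 3
        ring
  have hsub : {y | 2 * Real.exp (-x) < (posterior p Q n y).real U} ⊆ R ∪ S ∪ E ∪ Z := by
    intro y hy
    by_contra hnot
    simp only [Set.mem_union, not_or] at hnot
    obtain ⟨⟨⟨hyR, hyS⟩, hyE⟩, hyZ⟩ := hnot
    have hN : ∫⁻ l in U, likelihood p n y l ∂Q
        ≤ ENNReal.ofReal (Real.exp (-((C + 3) * x))) * likelihood p n y l₀ :=
      not_lt.1 fun h => hyS ⟨hyR, h⟩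
    have hD : ENNReal.ofReal (Real.exp (-(C * n * ξ ^ 2))) * likelihood p n y l₀
        ≤ 2 * (ENNReal.ofReal (Real.exp (2 * x)) * ∫⁻ l, likelihood p n y l ∂Q) :=
      not_lt.1 hyE
    have hpost := posterior_le (x := x) hyZ hD hN (le_of_eq (by simp only [x]; ring))
    have hlt : 2 * Real.exp (-x) < (posterior p Q n y).real U := hy
    exact absurd hlt (not_lt.2 (ENNReal.toReal_le_of_le_ofReal (by positivity) hpost))
  calc
    _ ≤ jointLaw μ p n l₀ (R ∪ S ∪ E ∪ Z) := measure_mono hsub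
    _ ≤ jointLaw μ p n l₀ R + jointLaw μ p n l₀ S + jointLaw μ p n l₀ E
          + jointLaw μ p n l₀ Z :=
      (measure_union_le _ _).trans (add_le_add_left ((measure_union_le _ _).trans
        (add_le_add_left (measure_union_le _ _) _)) _)
    _ ≤ ENNReal.ofReal (Real.exp (-x)) + ENNReal.ofReal (2 * Real.exp (-x))
          + ENNReal.ofReal (2 / x) + 0 := by
      gcongr
      · refine hR0.trans (ENNReal.ofReal_le_ofReal (Real.exp_le_exp.2 ?_))
        nlinarith
      · exact hZ.le
    _ = _ := by
      rw [add_zero, ← ENNReal.ofReal_add (by positivity) (by positivity),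
        ← ENNReal.ofReal_add (by positivity) (by positivity)]
      congr 1
      ring

end Posterior

end PosteriorContraction

theorem mainTheorem4
    {Λ : Type*} [MeasurableSpace Λ] {Y : ℕ → Type*} [∀ i, MeasurableSpace (Y i)]
    -- the dominating measures and the densities of the statistical model
    (μ : ∀ i, Measure (Y i)) [∀ i, SigmaFinite (μ i)]
    (p : ∀ i, Λ → Y i → ℝ≥0)
    (hp_meas : ∀ i, Measurable (fun q : Λ × Y i => p i q.1 q.2))
    (hp_one : ∀ i l, ∫⁻ y, (p i l y : ℝ≥0∞) ∂(μ i) = 1)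
    -- the true parameter and the prior for each sample size
    (l₀ : Λ) (Pi : ℕ → Measure Λ) [∀ n, IsProbabilityMeasure (Pi n)]
    -- the rate
    (ξ : ℕ → ℝ) (hξ_pos : ∀ᶠ n : ℕ in atTop, 0 < ξ n) (hξ_zero : Tendsto ξ atTop (𝓝 0))
    (hξ_top : Tendsto (fun n : ℕ => (n : ℝ) * ξ n ^ 2) atTop atTop)
    -- the sieves
    (F : ℕ → Set Λ) (hF_mono : Monotone F) (hF_meas : ∀ n, MeasurableSet (F n))
    (C : ℝ) (hC : 0 < C)
    (ha : ∀ᶠ n : ℕ in atTop,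
      Pi n (F n)ᶜ ≤ ENNReal.ofReal (Real.exp (-((n : ℝ) * ξ n ^ 2 * (C + 4)))))
    (hb : ∀ᶠ n : ℕ in atTop,
      ENNReal.log ((PosteriorContraction.coveringNumber
          (PosteriorContraction.hellingerDist μ p n) (ξ n) (F n) : ℕ∞) : ℝ≥0∞)
        ≤ (((n : ℝ) * ξ n ^ 2 : ℝ) : EReal))
    (hc : ∀ᶠ n : ℕ in atTop,
      ENNReal.ofReal (Real.exp (-(C * (n : ℝ) * ξ n ^ 2)))
        ≤ Pi n (PosteriorContraction.klNeighborhood μ p n l₀ (ξ n))) :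
    ∃ C₁ : ℝ, 0 < C₁ ∧ ∃ M₀ : ℝ, 0 < M₀ ∧ ∀ M : ℝ, M₀ ≤ M →
      PosteriorContraction.IsBigOInProb
        (fun n => PosteriorContraction.jointLaw μ p n l₀)
        (fun n y => (PosteriorContraction.posterior p (Pi n) n y).real
          {l | M * ξ n ≤ PosteriorContraction.hellingerDist μ p n l l₀})
        (fun n => Real.exp (-(C₁ * (n : ℝ) * ξ n ^ 2))) := by
  -- This M₀ solves M²/2 - 1 = 512(C + 5), the requirement of `exists_test` with K = C + 4.
  refine ⟨1, one_pos, Real.sqrt (2 * (512 * (C + 5) + 1)), by positivity, fun M hM ε hε => ?_⟩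
  have hM0 : 0 ≤ M := (Real.sqrt_nonneg _).trans hM
  have hCM : 512 * (C + 5) ≤ M ^ 2 / 2 - 1 := by
    have := (Real.sqrt_le_left hM0).1 hM
    linarith
  -- The constant 2 serves every ε, because the exceptional probability tends to zero.
  refine ⟨2, two_pos, ?_⟩
  have hlim : Tendsto (fun n : ℕ => 3 * Real.exp (-((n : ℝ) * ξ n ^ 2)) + 2 / ((n : ℝ) * ξ n ^ 2))
      atTop (𝓝 (3 * 0 + 0)) :=
    ((Real.tendsto_exp_neg_atTop_nhds_zero.comp hξ_top).const_mul 3).add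
      (hξ_top.const_div_atTop 2)
  filter_upwards [hξ_pos, ha, hb, hc, hlim.eventually_le_const (u := ε) (by simpa using hε),
    eventually_gt_atTop 0] with n hξn han hbn hcn hεn hn
  simp only [abs_of_nonneg measureReal_nonneg, one_mul]
  exact (PosteriorContraction.jointLaw_posterior_gt_le hp_meas hp_one l₀ (Nat.cast_pos.2 hn) hξn
    (hF_meas n) hC hM0 hCM han hbn hcn).trans (ENNReal.ofReal_le_ofReal hεn)
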